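/- **Theorem (Existence of $X$-space-regularised minimisers).** Let $(X,\mathsf d)$ be a complete separable metric space; write $\mathcal M(Z)$ for the set of finite nonnegative Radon measures on $Z$. Let $F:[0,\infty)\to[0,\infty]$ be convex and lower semicontinuous, with recession constant $F'_\infty:=\lim_{s\to\infty}F(s)/s\in[0,\infty]$. For $\gamma,\mu\in\mathcal M(Z)$ with Lebesgue decomposition $\gamma=\sigma\mu+\gamma^\perp$ put $$\mathcal F(\gamma\mid\mu):=\int_Z F(\sigma)\,d\mu+F'_\infty\,\gamma^\perp(Z)\qquad(\infty\cdot 0:=0).$$ Let $c:X\times X\to(-\infty,+\infty]$ be lower semicontinuous and bounded below, let $\varepsilon>0$, and assume that at least one of the following holds: (a) $F'_\infty=+\infty$ (for example the Kullback–Leibler entropy $F(s)=s\log s-s+1$); (b) the sublevel sets $\{c\le k\}$, $k\in\mathbb R$, are compact, and $(2+\varepsilon)F'_\infty+\inf_{X\times X}c>0$. Let $\mu_0,\mu_1\in\mathcal M(X)$ and $\nu_X\in\mathcal M(X\times X)$. Then the problem $$\mathrm{UOT}_{X,\varepsilon}(\mu_0,\mu_1):=\inf_{\gamma\in\mathcal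 M(X\times X)}\Big\{\mathcal F(\gamma_0\mid\mu_0)+\mathcal F(\gamma_1\mid\mu_1)+\int_{X\times X}c\,d\gamma+\varepsilon\,\mathcal F(\gamma\mid\nu_X)\Big\},$$ where $\gamma_0,\gamma_1$ are the marginals of $\gamma$, has at least one minimiser: there is $\gamma_\varepsilon\in\mathcal M(X\times X)$ at which the functional in braces equals $\mathrm{UOT}_{X,\varepsilon}(\mu_0,\mu_1)$. -/

import Mathlib

open MeasureTheory Filter Topology
open scoped NNReal ENNReal

namespace UnbalancedOT

noncomputable section

/-- The recession constant `F'_∞ = lim_{s → ∞} F(s) / s` of a function `F : [0,∞) → [0,∞]`.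
For a convex `F` the limit exists in `[0,∞]`, so it equals the upper limit used here. -/
def recession (F : ℝ≥0 → ℝ≥0∞) : ℝ≥0∞ :=
  limsup (fun s : ℝ≥0 => F s / (s : ℝ≥0∞)) atTop

/-- The relative entropy `𝓕(γ | μ) = ∫ F(σ) dμ + F'_∞ γ^⊥(Z)`, where `γ = σ μ + γ^⊥` is the
Lebesgue decomposition of `γ` with respect to `μ` (with the convention `∞ · 0 = 0`).
The density `σ` is finite `μ`-almost everywhere. -/
def relEntropy {Z : Type*} [MeasurableSpace Z] (F : ℝ≥0 → ℝ≥0∞) (γ μ : Measure Z) : ℝ≥0∞ :=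
  (∫⁻ z, F (γ.rnDeriv μ z).toNNReal ∂μ) + recession F * γ.singularPart μ Set.univ

/-- The linear cost `(c, γ) = ∫ c dγ ∈ [-∞,∞]`, as the integral of the positive part of `c` minus
that of its negative part. It is used for `c` bounded below and `γ` finite only, so that the
second integral is finite. -/
def linearCost {Z : Type*} [MeasurableSpace Z] (c : Z → EReal) (γ : Measure Z) : EReal :=
  ((∫⁻ z, (c z).toENNReal ∂γ : ℝ≥0∞) : EReal) - ((∫⁻ z, (-c z).toENNReal ∂γ : ℝ≥0∞) : EReal)

variable {X : Type*} [MeasurableSpace X]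

/-- The primal functional `𝓔(γ | μ₀, μ₁) = 𝓕(γ₀ | μ₀) + 𝓕(γ₁ | μ₁) + (c, γ)`,
with `γ₀, γ₁` the marginals of `γ`. -/
def primal (F : ℝ≥0 → ℝ≥0∞) (c : X × X → EReal) (μ₀ μ₁ : FiniteMeasure X)
    (γ : FiniteMeasure (X × X)) : EReal :=
  (relEntropy F (γ : Measure (X × X)).fst (μ₀ : Measure X) : EReal)
    + (relEntropy F (γ : Measure (X × X)).snd (μ₁ : Measure X) : EReal)
    + linearCost c (γ : Measure (X × X))

/-- The regularised functional `𝓔_ε(γ | μ₀, μ₁, ν) = 𝓔(γ | μ₀, μ₁) + ε 𝓕(γ | ν)`. -/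
def primalReg (F : ℝ≥0 → ℝ≥0∞) (c : X × X → EReal) (ε : ℝ) (μ₀ μ₁ : FiniteMeasure X)
    (ν : FiniteMeasure (X × X)) (γ : FiniteMeasure (X × X)) : EReal :=
  primal F c μ₀ μ₁ γ
    + (ε : EReal) * (relEntropy F (γ : Measure (X × X)) (ν : Measure (X × X)) : EReal)

/-- The value `UOT_{X,ε}(μ₀, μ₁) = inf_γ 𝓔_ε(γ | μ₀, μ₁, ν)`, over all finite measures `γ`. -/
def UOTReg (F : ℝ≥0 → ℝ≥0∞) (c : X × X → EReal) (ε : ℝ) (μ₀ μ₁ : FiniteMeasure X)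
    (ν : FiniteMeasure (X × X)) : EReal :=
  ⨅ γ : FiniteMeasure (X × X), primalReg F c ε μ₀ μ₁ ν γ

end

end UnbalancedOT

namespace UnbalancedOT

/-! The proof is the direct method for the weak topology on finite measures: the functional is
weakly lower semicontinuous, and its sublevel sets are bounded in mass and tight, hence lie in
weakly compact sets by Prokhorov's theorem.

Lower semicontinuity of the entropy comes from duality: `𝓕(γ | μ)` is the supremum of `∫ A dγ + ∫ B
dμ` over bounded continuous maps `(A, B)` into the set of affine minorants of `F`, and each such
expression is weakly continuous in `γ`. One inequality holds pointwise
(`ofReal_integral_add_le_relEntropy`). For the other, near-optimal minorants are selected measurably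
from a countable family and then smoothed, which is possible because the minorants form a convex set
(`exists_continuous_lt_relEntropy`). The cost, shifted to be nonnegative, is an increasing limit of
bounded Lipschitz functions.

Mass is controlled by a single minorant of slope `a` with `(2 + ε) a + b > 0` and `b ≤ c`: the three
entropies and the cost together grow at least at this rate in the mass. Tightness comes from the
superlinear entropy relative to the tight measure `ν` in case (a), and from Markov's inequality for
`c` in case (b). -/

/-- The coefficients `(a, b)` of the affine functions `s ↦ a s + b` lying below `F`. -/
def affineMinorants (F : ℝ≥0 → ℝ≥0∞) : Set (ℝ × ℝ) :=
  {p | ∀ s : ℝ≥0, ENNReal.ofReal (p.1 * s + p.2) ≤ F s}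

/-! ### Affine minorants and the recession constant -/

section AffineMinorants

variable {F : ℝ≥0 → ℝ≥0∞}

theorem zero_mem_affineMinorants : ((0, 0) : ℝ × ℝ) ∈ affineMinorants F := fun s => by simp

theorem affineMinorants_anti {p q : ℝ × ℝ} (hp : p ∈ affineMinorants F) (h₁ : q.1 ≤ p.1)
    (h₂ : q.2 ≤ p.2) : q ∈ affineMinorants F := fun s =>
  (ENNReal.ofReal_le_ofReal (add_le_add (mul_le_mul_of_nonneg_right h₁ s.2) h₂)).trans (hp s)

/-- The minorants form a convex set; this is what later allows a measurable choice of minorant to be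
smoothed into a continuous one. -/
theorem affineMinorants_combo {p q : ℝ × ℝ} (hp : p ∈ affineMinorants F)
    (hq : q ∈ affineMinorants F) {θ : ℝ} (h₀ : 0 ≤ θ) (h₁ : θ ≤ 1) :
    (p.1 + θ * (q.1 - p.1), p.2 + θ * (q.2 - p.2)) ∈ affineMinorants F := fun s => by
  have h : (p.1 + θ * (q.1 - p.1)) * s + (p.2 + θ * (q.2 - p.2))
      ≤ max (p.1 * s + p.2) (q.1 * s + q.2) := by
    have e₁ := le_max_left (p.1 * s + p.2) (q.1 * s + q.2)
    have e₂ := le_max_right (p.1 * s + p.2) (q.1 * s + q.2)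
    nlinarith [mul_le_mul_of_nonneg_left e₂ h₀, mul_le_mul_of_nonneg_left e₁ (sub_nonneg.2 h₁)]
  refine (ENNReal.ofReal_le_ofReal h).trans ?_
  rw [(ENNReal.ofReal_mono).map_max]
  exact max_le (hp s) (hq s)

/-- The epigraph of `F`, as a subset of the plane. -/
def realEpigraph (F : ℝ≥0 → ℝ≥0∞) : Set (ℝ × ℝ) :=
  {p | 0 ≤ p.1 ∧ 0 ≤ p.2 ∧ F p.1.toNNReal ≤ ENNReal.ofReal p.2}

theorem isClosed_realEpigraph (hF : LowerSemicontinuous F) : IsClosed (realEpigraph F) := by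
  have h : IsClosed {p : ℝ≥0 × ℝ≥0∞ | F p.1 ≤ p.2} := hF.isClosed_epigraph
  have hc : Continuous fun p : ℝ × ℝ => (p.1.toNNReal, ENNReal.ofReal p.2) :=
    (continuous_real_toNNReal.comp continuous_fst).prodMk
      (ENNReal.continuous_ofReal.comp continuous_snd)
  exact (isClosed_le continuous_const continuous_fst).inter
    ((isClosed_le continuous_const continuous_snd).inter (h.preimage hc))

theorem convex_realEpigraph (hF : ConvexOn ℝ≥0 Set.univ F) : Convex ℝ (realEpigraph F) := by
  rintro ⟨s, t⟩ ⟨hs, ht, hst⟩ ⟨s', t'⟩ ⟨hs', ht', hst'⟩ a b ha hb hab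
  simp only at hs ht hst hs' ht' hst'
  refine ⟨?_, ?_, ?_⟩
  · simp only [Prod.fst_add, Prod.smul_fst, smul_eq_mul]; positivity
  · simp only [Prod.snd_add, Prod.smul_snd, smul_eq_mul]; positivity
  · simp only [Prod.fst_add, Prod.smul_fst, smul_eq_mul, Prod.snd_add, Prod.smul_snd]
    have hab' : a.toNNReal + b.toNNReal = 1 := by
      rw [← Real.toNNReal_add ha hb, hab, Real.toNNReal_one]
    have h := hF.2 (Set.mem_univ s.toNNReal) (Set.mem_univ s'.toNNReal) zero_le zero_le hab'
    rw [Real.toNNReal_add (by positivity) (by positivity), Real.toNNReal_mul ha,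
      Real.toNNReal_mul hb, ENNReal.ofReal_add (by positivity) (by positivity),
      ENNReal.ofReal_mul ha, ENNReal.ofReal_mul hb]
    refine h.trans (add_le_add ?_ ?_)
    · rw [ENNReal.smul_def, smul_eq_mul]
      exact mul_le_mul_right hst _
    · rw [ENNReal.smul_def, smul_eq_mul]
      exact mul_le_mul_right hst' _

theorem toReal_mem_realEpigraph {s : ℝ≥0} (h : F s ≠ ⊤) {t : ℝ} (ht : (F s).toReal ≤ t) :
    ((s : ℝ), t) ∈ realEpigraph F :=
  ⟨s.2, ENNReal.toReal_nonneg.trans ht, by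
    simpa only [Real.toNNReal_coe] using (ENNReal.le_ofReal_iff_toReal_le h
      (ENNReal.toReal_nonneg.trans ht)).2 ht⟩

/-- A convex lower semicontinuous function is the supremum of its affine minorants. -/
theorem exists_affineMinorant_lt (hconv : ConvexOn ℝ≥0 Set.univ F) (hlsc : LowerSemicontinuous F)
    {s₀ : ℝ≥0} {y : ℝ≥0∞} (hy : y < F s₀) :
    ∃ p ∈ affineMinorants F, y < ENNReal.ofReal (p.1 * s₀ + p.2) := by
  lift y to ℝ≥0 using hy.ne_top
  suffices ∃ p ∈ affineMinorants F, (y : ℝ) < p.1 * s₀ + p.2 by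
    obtain ⟨p, hp, h⟩ := this
    refine ⟨p, hp, ?_⟩
    rw [← ENNReal.ofReal_coe_nnreal]
    exact (ENNReal.ofReal_lt_ofReal_iff_of_nonneg y.coe_nonneg).2 h
  by_cases htop : ∀ s, F s = ⊤
  · exact ⟨(0, y + 1), fun s => by simp [htop], by simp⟩
  push Not at htop
  obtain ⟨s₁, hs₁⟩ := htop
  have hnot : ((s₀ : ℝ), (y : ℝ)) ∉ realEpigraph F := fun h => by
    have := h.2.2
    simp only [Real.toNNReal_coe, ENNReal.ofReal_coe_nnreal] at this
    exact absurd this (not_le.2 hy)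
  obtain ⟨f, u, hu₀, hu⟩ := geometric_hahn_banach_point_closed (convex_realEpigraph hconv)
    (isClosed_realEpigraph hlsc) hnot
  set α := f (1, 0) with hα
  set β := f (0, 1) with hβ
  have hf : ∀ s t : ℝ, f (s, t) = α * s + β * t := fun s t => by
    have : ((s, t) : ℝ × ℝ) = s • (1, 0) + t • (0, 1) := by ext <;> simp
    rw [this, map_add, map_smul, map_smul, smul_eq_mul, smul_eq_mul, mul_comm, mul_comm t]
  rw [hf] at hu₀
  have hu' : ∀ s : ℝ≥0, F s ≠ ⊤ → ∀ t : ℝ, (F s).toReal ≤ t → u < α * s + β * t :=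
    fun s h t ht => hf s t ▸ hu _ (toReal_mem_realEpigraph h ht)
  -- The epigraph is unbounded upwards above `s₁`, so the separating functional cannot decrease in
  -- `t`.
  have hβ0 : 0 ≤ β := by
    by_contra hneg
    push Not at hneg
    have h := hu' s₁ hs₁ (max (F s₁).toReal ((u - α * s₁) / β)) (le_max_left _ _)
    have h2 := mul_le_mul_of_nonpos_left (le_max_right (F s₁).toReal ((u - α * s₁) / β)) hneg.le
    rw [mul_div_cancel₀ _ hneg.ne] at h2
    linarith
  -- If the hyperplane is vertical, `s ↦ u - α s` is negative wherever `F` is finite and positive at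
  -- `s₀`; scaling it to equal `y + 1` at `s₀` gives the minorant. Otherwise the hyperplane is
  -- itself the graph of one.
  rcases hβ0.eq_or_lt with h0 | hpos
  · rw [← h0] at hu₀ hu'
    have hd : 0 < u - α * s₀ := by linarith
    refine ⟨(-((y + 1) / (u - α * s₀) * α), (y + 1) / (u - α * s₀) * u), fun s => ?_, ?_⟩
    · by_cases hs : F s = ⊤
      · simp [hs]
      · have h := hu' s hs _ le_rfl
        rw [ENNReal.ofReal_of_nonpos]
        · exact zero_le
        · have : 0 ≤ ((y : ℝ) + 1) / (u - α * s₀) := by positivity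
          simp only
          nlinarith
    · have : -((y + 1) / (u - α * s₀) * α) * s₀ + (y + 1) / (u - α * s₀) * u = (y : ℝ) + 1 := by
        field_simp
        ring
      simp only [this]
      linarith
  · refine ⟨(-(α / β), u / β), fun s => ?_, ?_⟩
    · by_cases hs : F s = ⊤
      · simp [hs]
      · have h := hu' s hs _ le_rfl
        refine ENNReal.ofReal_le_of_le_toReal ?_
        have : -(α / β) * s + u / β = (u - α * s) / β := by field_simp; ring
        simp only [this]
        rw [div_le_iff₀ hpos]
        linarith
    · have : -(α / β) * s₀ + u / β = (u - α * s₀) / β := by field_simp; ring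
      simp only [this]
      rw [lt_div_iff₀ hpos]
      linarith

theorem ofReal_le_recession {p : ℝ × ℝ} (hp : p ∈ affineMinorants F) :
    ENNReal.ofReal p.1 ≤ recession F := by
  have h : Tendsto (fun s : ℝ≥0 => ENNReal.ofReal (p.1 + p.2 / s)) atTop
      (𝓝 (ENNReal.ofReal p.1)) := by
    refine ENNReal.tendsto_ofReal ?_
    have : Tendsto (fun s : ℝ≥0 => p.2 / (s : ℝ)) atTop (𝓝 0) :=
      Tendsto.div_atTop tendsto_const_nhds (NNReal.tendsto_coe_atTop.2 tendsto_id)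
    simpa using this.const_add p.1
  rw [← h.limsup_eq]
  refine limsup_le_limsup ?_
  filter_upwards [eventually_gt_atTop 0] with s hs
  have hs' : (0 : ℝ) < s := hs
  rw [ENNReal.le_div_iff_mul_le (Or.inl (by simpa using hs.ne')) (Or.inl ENNReal.coe_ne_top),
    ← ENNReal.ofReal_coe_nnreal, ← ENNReal.ofReal_mul' s.coe_nonneg]
  have : (p.1 + p.2 / s) * s = p.1 * s + p.2 := by field_simp
  rw [this]
  exact hp s

/-- If all slopes are at most `r`, each minorant, and so `F`, grows at rate at most `r` beyond a
point where `F` is finite. With `ofReal_le_recession`, the recession constant is thus the supremum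
of the positive parts of the slopes. -/
theorem recession_le (hconv : ConvexOn ℝ≥0 Set.univ F) (hlsc : LowerSemicontinuous F) {r : ℝ≥0∞}
    (hr : ∀ p ∈ affineMinorants F, ENNReal.ofReal p.1 ≤ r) : recession F ≤ r := by
  by_cases hrtop : r = ⊤
  · simp [hrtop]
  lift r to ℝ≥0 using hrtop
  by_cases htop : ∀ s, F s = ⊤
  · have := hr (r + 1, 0) (fun s => by simp [htop])
    rw [ENNReal.ofReal_le_iff_le_toReal ENNReal.coe_ne_top] at this
    simp at this
    linarith
  push Not at htop
  obtain ⟨s₁, hs₁⟩ := htop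
  have key : ∀ s, s₁ ≤ s → F s ≤ F s₁ + r * s := fun s hs => by
    refine le_of_forall_lt fun y hy => ?_
    obtain ⟨p, hp, hpy⟩ := exists_affineMinorant_lt hconv hlsc hy
    refine hpy.trans_le ?_
    have hp1 : p.1 ≤ r := by
      have := hr p hp
      rw [ENNReal.ofReal_le_iff_le_toReal ENNReal.coe_ne_top] at this
      simpa using this
    have h1 : p.1 * s + p.2 ≤ (p.1 * s₁ + p.2) + r * s := by
      have : (s₁ : ℝ) ≤ s := hs
      nlinarith [mul_le_mul_of_nonneg_right hp1 (sub_nonneg.2 this), mul_nonneg r.2 s₁.2]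
    calc _ ≤ ENNReal.ofReal ((p.1 * s₁ + p.2) + r * s) := ENNReal.ofReal_le_ofReal h1
      _ ≤ ENNReal.ofReal (p.1 * s₁ + p.2) + ENNReal.ofReal (r * s) := ENNReal.ofReal_add_le
      _ ≤ _ := by
        refine add_le_add (hp s₁) ?_
        rw [ENNReal.ofReal_mul r.coe_nonneg]
        simp
  have h : Tendsto (fun s : ℝ≥0 => F s₁ / s + r) atTop (𝓝 (0 + r)) := by
    refine Tendsto.add ?_ tendsto_const_nhds
    have h1 : Tendsto (fun s : ℝ≥0 => (s : ℝ≥0∞)) atTop (𝓝 ⊤) :=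
      ENNReal.tendsto_coe_nhds_top.2 tendsto_id
    have := ENNReal.Tendsto.const_div h1 (Or.inr hs₁)
    simpa using this
  rw [zero_add] at h
  rw [← h.limsup_eq]
  refine limsup_le_limsup ?_
  filter_upwards [eventually_ge_atTop s₁, eventually_gt_atTop 0] with s hs hs0
  refine (ENNReal.div_le_div_right (key s hs) _).trans ?_
  rw [ENNReal.add_div, ENNReal.mul_div_cancel_right (by simpa using hs0.ne') ENNReal.coe_ne_top]

theorem exists_affineMinorant_slope_gt (hconv : ConvexOn ℝ≥0 Set.univ F)
    (hlsc : LowerSemicontinuous F) {r : ℝ≥0∞} (hr : r < recession F) :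
    ∃ p ∈ affineMinorants F, r < ENNReal.ofReal p.1 := by
  by_contra! h
  exact absurd (recession_le hconv hlsc h) (not_le.2 hr)

end AffineMinorants

/-! ### Measurable selection of near-optimal minorants -/

section Maximisers

variable {Z : Type*} {F : ℝ≥0 → ℝ≥0∞}

/-- The successive maximisers of `p ↦ p.1 f + p.2 g` among `0, e 0, e 1, …`. -/
noncomputable def maximisers (e : ℕ → ℝ × ℝ) (f g : Z → ℝ) : ℕ → Z → ℝ × ℝ
  | 0 => fun _ => (0, 0)
  | n + 1 => fun z =>
      if (maximisers e f g n z).1 * f z + (maximisers e f g n z).2 * g z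
          < (e n).1 * f z + (e n).2 * g z then e n
      else maximisers e f g n z

variable {e : ℕ → ℝ × ℝ} {f g : Z → ℝ}

theorem measurableSet_maximisers_lt [MeasurableSpace Z] (hf : Measurable f) (hg : Measurable g) (n : ℕ)
    (h : Measurable (maximisers e f g n)) :
    MeasurableSet {z | (maximisers e f g n z).1 * f z + (maximisers e f g n z).2 * g z
      < (e n).1 * f z + (e n).2 * g z} :=
  measurableSet_lt ((h.fst.mul hf).add (h.snd.mul hg))
    ((hf.const_mul _).add (hg.const_mul _))

theorem measurable_maximisers [MeasurableSpace Z] (hf : Measurable f) (hg : Measurable g) (n : ℕ) :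
    Measurable (maximisers e f g n) := by
  induction n with
  | zero => exact measurable_const
  | succ n ih =>
    exact Measurable.ite (measurableSet_maximisers_lt hf hg n ih) measurable_const ih

theorem maximisers_mem (he : ∀ n, e n ∈ affineMinorants F) (n : ℕ) (z : Z) :
    maximisers e f g n z ∈ affineMinorants F := by
  induction n with
  | zero => exact zero_mem_affineMinorants
  | succ n ih =>
    simp only [maximisers]
    split_ifs
    exacts [he n, ih]

theorem exists_norm_maximisers_le (n : ℕ) : ∃ M : ℝ, ∀ z : Z, ‖maximisers e f g n z‖ ≤ M := by
  induction n with
  | zero => exact ⟨0, fun z => by simp [maximisers]⟩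
  | succ n ih =>
    obtain ⟨M, hM⟩ := ih
    refine ⟨max M ‖e n‖, fun z => ?_⟩
    simp only [maximisers]
    split_ifs
    exacts [le_max_right _ _, (hM z).trans (le_max_left _ _)]

theorem maximisers_value_le_succ (n : ℕ) (z : Z) :
    (maximisers e f g n z).1 * f z + (maximisers e f g n z).2 * g z
      ≤ (maximisers e f g (n + 1) z).1 * f z + (maximisers e f g (n + 1) z).2 * g z := by
  simp only [maximisers]
  split_ifs with h
  exacts [h.le, le_rfl]

theorem value_le_maximisers_succ (n : ℕ) (z : Z) :
    (e n).1 * f z + (e n).2 * g z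
      ≤ (maximisers e f g (n + 1) z).1 * f z + (maximisers e f g (n + 1) z).2 * g z := by
  simp only [maximisers]
  split_ifs with h
  exacts [le_rfl, not_lt.1 h]

theorem maximisers_value_mono (z : Z) :
    Monotone fun n => (maximisers e f g n z).1 * f z + (maximisers e f g n z).2 * g z :=
  monotone_nat_of_le_succ fun n => maximisers_value_le_succ n z

/-- The selection starts at the zero minorant and its values only increase; nonnegativity lets
`ENNReal.ofReal` pass through the integral. -/
theorem maximisers_value_nonneg (n : ℕ) (z : Z) :
    0 ≤ (maximisers e f g n z).1 * f z + (maximisers e f g n z).2 * g z :=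
  le_trans (by simp [maximisers]) (maximisers_value_mono z (Nat.zero_le n))

end Maximisers

/-! ### The entropy as the integral of a perspective function -/

section EntropyDensity

variable {Z : Type*} [MeasurableSpace Z] {F : ℝ≥0 → ℝ≥0∞}

theorem integrable_mul_of_bounded {ρ : Measure Z} {A f : Z → ℝ} (hA : Measurable A)
    {M : ℝ} (hM : ∀ z, |A z| ≤ M) (hf : Integrable f ρ) : Integrable (fun z => A z * f z) ρ :=
  hf.bdd_mul hA.aestronglyMeasurable (ae_of_all _ fun z => by simpa using hM z)

theorem integrable_of_bounded {ρ : Measure Z} [IsFiniteMeasure ρ] {A : Z → ℝ} (hA : Measurable A)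
    {M : ℝ} (hM : ∀ z, |A z| ≤ M) : Integrable A ρ := by
  simpa using integrable_mul_of_bounded hA hM (integrable_const (1 : ℝ))

/-- The relative entropy as the integral of one density `H`, the supremum of the perspectives
`a f + b g` of the affine minorants of the entropy function. -/
theorem exists_entropyDensity (hconv : ConvexOn ℝ≥0 Set.univ F) (hlsc : LowerSemicontinuous F)
    (γ μ : Measure Z) [IsFiniteMeasure γ] [IsFiniteMeasure μ] :
    ∃ (ρ : Measure Z) (f g : Z → ℝ) (H : Z → ℝ≥0∞), Measurable f ∧ Measurable g ∧
      (∀ z, 0 ≤ f z) ∧ (∀ z, 0 ≤ g z) ∧ relEntropy F γ μ = ∫⁻ z, H z ∂ρ ∧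
      (∀ A B : Z → ℝ, Measurable A → Measurable B → ∀ M : ℝ, (∀ z, |A z| ≤ M) →
        (∀ z, |B z| ≤ M) → Integrable (fun z => A z * f z + B z * g z) ρ ∧
        ∫ z, A z ∂γ + ∫ z, B z ∂μ = ∫ z, A z * f z + B z * g z ∂ρ) ∧
      (∀ z, ∀ p ∈ affineMinorants F, ENNReal.ofReal (p.1 * f z + p.2 * g z) ≤ H z) ∧
      ∀ z y, y < H z → ∃ p ∈ affineMinorants F, y < ENNReal.ofReal (p.1 * f z + p.2 * g z) := by
  classical
  obtain ⟨S, hS, hγS, hμS⟩ := Measure.mutuallySingular_singularPart γ μ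
  set π := γ.singularPart μ with hπ
  have hμS' : ∀ᵐ z ∂μ, z ∈ S := hμS
  have hπS : ∀ᵐ z ∂π, z ∉ S := by
    rw [ae_iff]; simpa using hγS
  -- `S` carries `μ` and its complement carries `π`, the singular part of `γ`. Here `f` and `g` act
  -- as densities of `γ` and `μ` with respect to `μ + π`: the supremum of `a f + b g` is `F(σ)` on
  -- `S` and the recession constant off it.
  set f : Z → ℝ := fun z => if z ∈ S then (γ.rnDeriv μ z).toReal else 1 with hf
  set g : Z → ℝ := fun z => if z ∈ S then 1 else 0 with hg
  set H : Z → ℝ≥0∞ := fun z => if z ∈ S then F (γ.rnDeriv μ z).toNNReal else recession F with hH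
  have hfm : Measurable f :=
    Measurable.ite hS (Measure.measurable_rnDeriv γ μ).ennreal_toReal measurable_const
  have hgm : Measurable g := Measurable.ite hS measurable_const measurable_const
  have hFm : Measurable F := hlsc.measurable
  have hHm : Measurable H :=
    Measurable.ite hS (hFm.comp (Measure.measurable_rnDeriv γ μ).ennreal_toNNReal) measurable_const
  have hfμ : f =ᵐ[μ] fun z => (γ.rnDeriv μ z).toReal := by
    filter_upwards [hμS'] with z hz
    simp [hf, hz]
  have hfπ : f =ᵐ[π] fun _ => 1 := by
    filter_upwards [hπS] with z hz
    simp [hf, hz]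
  refine ⟨μ + π, f, g, H, hfm, hgm, fun z => ?_, fun z => ?_, ?_, ?_, ?_, ?_⟩
  · simp only [hf]; split_ifs <;> simp
  · simp only [hg]; split_ifs <;> simp
  · rw [lintegral_add_measure, relEntropy]
    congr 1
    · refine lintegral_congr_ae ?_
      filter_upwards [hμS'] with z hz
      simp [hH, hz]
    · rw [← lintegral_const]
      refine lintegral_congr_ae ?_
      filter_upwards [hπS] with z hz
      simp [hH, hz]
  · intro A B hA hB M hAM hBM
    have hσ : Integrable (fun z => (γ.rnDeriv μ z).toReal) μ := Measure.integrable_toReal_rnDeriv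
    have hAi : Integrable (fun z => A z * (γ.rnDeriv μ z).toReal) μ :=
      integrable_mul_of_bounded hA hAM hσ
    have e₁ : (fun z => A z * f z + B z * g z) =ᵐ[μ]
        fun z => A z * (γ.rnDeriv μ z).toReal + B z := by
      filter_upwards [hμS'] with z hz
      simp [hf, hg, hz]
    have e₂ : (fun z => A z * f z + B z * g z) =ᵐ[π] A := by
      filter_upwards [hπS] with z hz
      simp [hf, hg, hz]
    have i₁ : Integrable (fun z => A z * f z + B z * g z) μ :=
      (hAi.add (integrable_of_bounded hB hBM)).congr e₁.symm
    have i₂ : Integrable (fun z => A z * f z + B z * g z) π :=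
      (integrable_of_bounded hA hAM).congr e₂.symm
    refine ⟨i₁.add_measure i₂, ?_⟩
    rw [integral_add_measure i₁ i₂, integral_congr_ae e₁, integral_congr_ae e₂,
      integral_add hAi (integrable_of_bounded hB hBM)]
    have hsplit : ∫ z, A z ∂γ = ∫ z, A z ∂π + ∫ z, A z * (γ.rnDeriv μ z).toReal ∂μ := by
      conv_lhs => rw [← Measure.singularPart_add_rnDeriv γ μ]
      rw [integral_add_measure (integrable_of_bounded hA hAM) (integrable_of_bounded hA hAM),
        integral_withDensity_eq_integral_toReal_smul (Measure.measurable_rnDeriv γ μ)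
          (Measure.rnDeriv_lt_top γ μ)]
      simp [hπ, mul_comm]
    rw [hsplit]
    ring
  · intro z p hp
    simp only [hf, hg, hH]
    split_ifs with hz
    · simpa [ENNReal.coe_toNNReal_eq_toReal] using hp (γ.rnDeriv μ z).toNNReal
    · simpa using ofReal_le_recession hp
  · intro z y hy
    simp only [hf, hg, hH] at hy ⊢
    split_ifs at hy ⊢ with hz
    · simpa [ENNReal.coe_toNNReal_eq_toReal] using exists_affineMinorant_lt hconv hlsc hy
    · simpa using exists_affineMinorant_slope_gt hconv hlsc hy

theorem ofReal_integral_le_lintegral_ofReal {ρ : Measure Z} {φ : Z → ℝ} (hφ : Integrable φ ρ) :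
    ENNReal.ofReal (∫ z, φ z ∂ρ) ≤ ∫⁻ z, ENNReal.ofReal (φ z) ∂ρ := by
  have h : ∫ z, φ z ∂ρ ≤ ∫ z, max (φ z) 0 ∂ρ :=
    integral_mono hφ hφ.pos_part fun z => le_max_left _ _
  refine (ENNReal.ofReal_le_ofReal h).trans ?_
  rw [ofReal_integral_eq_lintegral_ofReal hφ.pos_part (ae_of_all _ fun z => le_max_right _ _)]
  exact lintegral_mono fun z => by simp

/-- The easy half of the duality: integrate the pointwise bound `A f + B g ≤ H`. -/
theorem ofReal_integral_add_le_relEntropy (hconv : ConvexOn ℝ≥0 Set.univ F)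
    (hlsc : LowerSemicontinuous F) (γ μ : Measure Z) [IsFiniteMeasure γ] [IsFiniteMeasure μ]
    {A B : Z → ℝ} (hA : Measurable A) (hB : Measurable B) {M : ℝ} (hAM : ∀ z, |A z| ≤ M)
    (hBM : ∀ z, |B z| ≤ M) (hAB : ∀ z, (A z, B z) ∈ affineMinorants F) :
    ENNReal.ofReal (∫ z, A z ∂γ + ∫ z, B z ∂μ) ≤ relEntropy F γ μ := by
  obtain ⟨ρ, f, g, H, -, -, -, -, hR, hint, hle, -⟩ := exists_entropyDensity hconv hlsc γ μ
  obtain ⟨hi, he⟩ := hint A B hA hB M hAM hBM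
  rw [hR, he]
  exact (ofReal_integral_le_lintegral_ofReal hi).trans (lintegral_mono fun z => hle z _ (hAB z))

/-- Lowering the coefficients of a minorant gives a minorant, so rational ones suffice. -/
theorem exists_seq_dense_affineMinorants (F : ℝ≥0 → ℝ≥0∞) :
    ∃ e : ℕ → ℝ × ℝ, (∀ n, e n ∈ affineMinorants F) ∧ ∀ p ∈ affineMinorants F, ∀ δ > 0,
      ∃ n, p.1 - δ < (e n).1 ∧ p.2 - δ < (e n).2 := by
  let Q := {q : ℚ × ℚ // ((q.1 : ℝ), (q.2 : ℝ)) ∈ affineMinorants F}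
  have : Nonempty Q := ⟨⟨(0, 0), by simpa using zero_mem_affineMinorants⟩⟩
  obtain ⟨e, he⟩ := exists_surjective_nat Q
  refine ⟨fun n => ((e n).1.1, (e n).1.2), fun n => (e n).2, fun p hp δ hδ => ?_⟩
  obtain ⟨a, ha, ha'⟩ := exists_rat_btwn (sub_lt_self p.1 hδ)
  obtain ⟨b, hb, hb'⟩ := exists_rat_btwn (sub_lt_self p.2 hδ)
  obtain ⟨n, hn⟩ := he ⟨(a, b), affineMinorants_anti hp ha'.le hb'.le⟩
  exact ⟨n, by simp [hn, ha], by simp [hn, hb]⟩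

end EntropyDensity

/-! ### Continuous test functions and lower semicontinuity of the entropy -/

section LowerSemicontinuity

variable {Z : Type*} [MeasurableSpace Z] {F : ℝ≥0 → ℝ≥0∞}

/-- The values of the successive maximisers increase to the density `H`, so monotone convergence
applies. -/
theorem exists_measurable_lt_relEntropy (hconv : ConvexOn ℝ≥0 Set.univ F)
    (hlsc : LowerSemicontinuous F) (γ μ : Measure Z) [IsFiniteMeasure γ] [IsFiniteMeasure μ]
    {y : ℝ≥0∞} (hy : y < relEntropy F γ μ) :
    ∃ (e : ℕ → ℝ × ℝ) (f g : Z → ℝ) (n : ℕ), (∀ n, e n ∈ affineMinorants F) ∧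
      Measurable f ∧ Measurable g ∧ y < ENNReal.ofReal (∫ z, (maximisers e f g n z).1 ∂γ +
        ∫ z, (maximisers e f g n z).2 ∂μ) := by
  obtain ⟨ρ, f, g, H, hf, hg, hf0, hg0, hR, hint, hle, hlt⟩ := exists_entropyDensity hconv hlsc γ μ
  obtain ⟨e, he, hdense⟩ := exists_seq_dense_affineMinorants F
  have hH : ∀ z, H z = ⨆ n, ENNReal.ofReal
      ((maximisers e f g n z).1 * f z + (maximisers e f g n z).2 * g z) := fun z => by
    refine le_antisymm (le_of_forall_lt fun y hy => ?_)
      (iSup_le fun n => hle z _ (maximisers_mem he n z))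
    obtain ⟨p, hp, hpy⟩ := hlt z y hy
    lift y to ℝ≥0 using hy.ne_top
    rw [← ENNReal.ofReal_coe_nnreal, ENNReal.ofReal_lt_ofReal_iff_of_nonneg y.coe_nonneg] at hpy
    have hd : 0 < f z + g z + 1 := by linarith [hf0 z, hg0 z]
    set v := p.1 * f z + p.2 * g z with hv
    -- Lowering both coefficients by this amount costs `(v - y)(f + g)/(f + g + 1)`, less than `v -
    -- y`.
    obtain ⟨n, h₁, h₂⟩ := hdense p hp ((v - y) / (f z + g z + 1)) (div_pos (by linarith) hd)
    have hlt' : (y : ℝ) < (e n).1 * f z + (e n).2 * g z := by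
      have k₁ := mul_le_mul_of_nonneg_right h₁.le (hf0 z)
      have k₂ := mul_le_mul_of_nonneg_right h₂.le (hg0 z)
      have k₃ : (v - y) / (f z + g z + 1) * (f z + g z + 1) = v - y := div_mul_cancel₀ _ hd.ne'
      have k₄ : 0 < (v - y) / (f z + g z + 1) := div_pos (by linarith) hd
      nlinarith
    refine lt_of_lt_of_le ?_ (le_iSup _ (n + 1))
    rw [← ENNReal.ofReal_coe_nnreal]
    exact (ENNReal.ofReal_lt_ofReal_iff_of_nonneg y.coe_nonneg).2
      (hlt'.trans_le (value_le_maximisers_succ n z))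
  have hm := fun n => measurable_maximisers (e := e) hf hg n
  have hRsup : relEntropy F γ μ = ⨆ n, ENNReal.ofReal (∫ z, (maximisers e f g n z).1 ∂γ +
      ∫ z, (maximisers e f g n z).2 ∂μ) := by
    rw [hR, lintegral_congr hH, lintegral_iSup]
    · refine iSup_congr fun n => ?_
      obtain ⟨M, hM⟩ := exists_norm_maximisers_le (e := e) (f := f) (g := g) n
      obtain ⟨hi, hE⟩ := hint _ _ (hm n).fst (hm n).snd M
        (fun z => (norm_fst_le _).trans (hM z)) (fun z => (norm_snd_le _).trans (hM z))
      rw [hE, ofReal_integral_eq_lintegral_ofReal hi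
        (ae_of_all _ fun z => maximisers_value_nonneg n z)]
    · exact fun n => (((hm n).fst.mul hf).add ((hm n).snd.mul hg)).ennreal_ofReal
    · exact fun m n hmn z => ENNReal.ofReal_le_ofReal (maximisers_value_mono z hmn)
  rw [hRsup, lt_iSup_iff] at hy
  obtain ⟨n, hn⟩ := hy
  exact ⟨e, f, g, n, he, hf, hg, hn⟩

variable [PseudoMetricSpace Z] [BorelSpace Z]

/-- Bounded continuous functions are dense in `L¹`; pass to an almost everywhere convergent
subsequence and clamp to `[0, 1]`. -/
theorem exists_continuous_seq_tendsto_indicator (ρ : Measure Z) [IsFiniteMeasure ρ] {E : Set Z}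
    (hE : MeasurableSet E) :
    ∃ θ : ℕ → Z → ℝ, (∀ k, Continuous (θ k)) ∧ (∀ k z, 0 ≤ θ k z) ∧ (∀ k z, θ k z ≤ 1) ∧
      ∀ᵐ z ∂ρ, Tendsto (fun k => θ k z) atTop (𝓝 (E.indicator 1 z)) := by
  have hmem : MemLp (E.indicator (1 : Z → ℝ)) 1 ρ := by
    refine MemLp.indicator hE ?_
    exact memLp_const 1
  have hk : ∀ k : ℕ, ((k : ℝ≥0∞) + 1)⁻¹ ≠ 0 := fun k => by simp
  choose g hg hgm using fun k : ℕ =>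
    hmem.exists_boundedContinuous_eLpNorm_sub_le ENNReal.one_ne_top (hk k)
  have hlim : Tendsto (fun k => eLpNorm (⇑(g k) - E.indicator (1 : Z → ℝ)) 1 ρ) atTop (𝓝 0) := by
    have h0 : Tendsto (fun k : ℕ => ((k : ℝ≥0∞) + 1)⁻¹) atTop (𝓝 0) := by
      have := (tendsto_add_atTop_iff_nat 1).2 ENNReal.tendsto_inv_nat_nhds_zero
      simpa using this
    refine tendsto_of_tendsto_of_tendsto_of_le_of_le tendsto_const_nhds h0
      (fun _ => zero_le) fun k => ?_
    rw [eLpNorm_sub_comm]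
    exact hg k
  obtain ⟨ns, -, hns⟩ := (tendstoInMeasure_of_tendsto_eLpNorm one_ne_zero
    (fun k => (hgm k).aestronglyMeasurable) hmem.aestronglyMeasurable hlim).exists_seq_tendsto_ae
  refine ⟨fun k z => max 0 (min 1 (g (ns k) z)), fun k => ?_, fun k z => le_max_left _ _,
    fun k z => max_le zero_le_one (min_le_left _ _), ?_⟩
  · exact continuous_const.max (continuous_const.min (g (ns k)).continuous)
  · filter_upwards [hns] with z hz
    have h : max 0 (min 1 (E.indicator (1 : Z → ℝ) z)) = E.indicator 1 z := by
      by_cases hzE : z ∈ E <;> simp [hzE]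
    rw [← h]
    exact tendsto_const_nhds.max (tendsto_const_nhds.min hz)

/-- Each selection stage switches to `e n` on a measurable set. Replacing its indicator by
continuous weights in `[0, 1]` turns the switch into a convex combination, which remains a minorant.
-/
theorem exists_continuous_seq_tendsto_maximisers {e : ℕ → ℝ × ℝ} {f g : Z → ℝ}
    (he : ∀ n, e n ∈ affineMinorants F) (hf : Measurable f) (hg : Measurable g)
    (ρ : Measure Z) [IsFiniteMeasure ρ] (n : ℕ) :
    ∃ (M : ℝ) (Q : ℕ → Z → ℝ × ℝ), (∀ k, Continuous (Q k)) ∧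
      (∀ k z, Q k z ∈ affineMinorants F) ∧ (∀ k z, ‖Q k z‖ ≤ M) ∧
      ∀ᵐ z ∂ρ, Tendsto (fun k => Q k z) atTop (𝓝 (maximisers e f g n z)) := by
  induction n with
  | zero =>
    exact ⟨0, fun _ _ => (0, 0), fun _ => continuous_const, fun _ _ => zero_mem_affineMinorants,
      fun _ _ => by simp, ae_of_all _ fun _ => tendsto_const_nhds⟩
  | succ n ih =>
    obtain ⟨M, Q, hQc, hQmem, hQM, hQ⟩ := ih
    obtain ⟨θ, hθc, hθ0, hθ1, hθ⟩ := exists_continuous_seq_tendsto_indicator ρ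
      (measurableSet_maximisers_lt (e := e) hf hg n (measurable_maximisers hf hg n))
    refine ⟨M + (‖e n‖ + M), fun k z => Q k z + θ k z • (e n - Q k z), fun k => ?_, fun k z => ?_,
      fun k z => ?_, ?_⟩
    · exact (hQc k).add ((hθc k).smul (continuous_const.sub (hQc k)))
    · exact affineMinorants_combo (hQmem k z) (he n) (hθ0 k z) (hθ1 k z)
    · refine (norm_add_le _ _).trans (add_le_add (hQM k z) ?_)
      rw [norm_smul, Real.norm_of_nonneg (hθ0 k z)]
      refine (mul_le_of_le_one_left (norm_nonneg _) (hθ1 k z)).trans ?_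
      exact (norm_sub_le _ _).trans (add_le_add le_rfl (hQM k z))
    · filter_upwards [hQ, hθ] with z hz hz'
      have h := hz.add (hz'.smul (tendsto_const_nhds (x := e n).sub hz))
      convert h using 2
      simp only [maximisers, Set.indicator_apply, Set.mem_ofPred_eq]
      split_ifs <;> simp

theorem exists_continuous_lt_relEntropy (hconv : ConvexOn ℝ≥0 Set.univ F)
    (hlsc : LowerSemicontinuous F) (γ μ : Measure Z) [IsFiniteMeasure γ] [IsFiniteMeasure μ]
    {y : ℝ≥0∞} (hy : y < relEntropy F γ μ) :
    ∃ (M : ℝ) (Q : Z → ℝ × ℝ), Continuous Q ∧ (∀ z, Q z ∈ affineMinorants F) ∧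
      (∀ z, ‖Q z‖ ≤ M) ∧ y < ENNReal.ofReal (∫ z, (Q z).1 ∂γ + ∫ z, (Q z).2 ∂μ) := by
  obtain ⟨e, f, g, n, he, hf, hg, hn⟩ := exists_measurable_lt_relEntropy hconv hlsc γ μ hy
  obtain ⟨M, Q, hQc, hQmem, hQM, hQ⟩ :=
    exists_continuous_seq_tendsto_maximisers he hf hg (γ + μ) n
  have l₁ : Tendsto (fun k => ∫ z, (Q k z).1 ∂γ) atTop (𝓝 (∫ z, (maximisers e f g n z).1 ∂γ)) := by
    refine tendsto_integral_of_dominated_convergence (fun _ => M)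
      (fun k => (hQc k).fst.measurable.aestronglyMeasurable) (integrable_const M)
      (fun k => ae_of_all _ fun z => (norm_fst_le _).trans (hQM k z)) ?_
    filter_upwards [(ae_add_measure_iff.1 hQ).1] with z hz
    exact (continuous_fst.tendsto _).comp hz
  have l₂ : Tendsto (fun k => ∫ z, (Q k z).2 ∂μ) atTop (𝓝 (∫ z, (maximisers e f g n z).2 ∂μ)) := by
    refine tendsto_integral_of_dominated_convergence (fun _ => M)
      (fun k => (hQc k).snd.measurable.aestronglyMeasurable) (integrable_const M)
      (fun k => ae_of_all _ fun z => (norm_snd_le _).trans (hQM k z)) ?_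
    filter_upwards [(ae_add_measure_iff.1 hQ).2] with z hz
    exact (continuous_snd.tendsto _).comp hz
  obtain ⟨k, hk⟩ := ((ENNReal.tendsto_ofReal (l₁.add l₂)).eventually_const_lt hn).exists
  exact ⟨M, Q k, hQc k, hQmem k, hQM k, hk⟩

/-- The relative entropy is weakly lower semicontinuous in its first argument. -/
theorem lowerSemicontinuous_relEntropy (hconv : ConvexOn ℝ≥0 Set.univ F)
    (hlsc : LowerSemicontinuous F) (μ : Measure Z) [IsFiniteMeasure μ] :
    LowerSemicontinuous fun γ : FiniteMeasure Z => relEntropy F (γ : Measure Z) μ := by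
  intro γ y hy
  obtain ⟨M, Q, hQc, hQmem, hQM, hlt⟩ := exists_continuous_lt_relEntropy hconv hlsc _ μ hy
  let A : BoundedContinuousFunction Z ℝ := BoundedContinuousFunction.ofNormedAddCommGroup
    (fun z => (Q z).1) hQc.fst M fun z => (norm_fst_le _).trans (hQM z)
  have hcont : Continuous fun η : FiniteMeasure Z =>
      ENNReal.ofReal (∫ z, (Q z).1 ∂(η : Measure Z) + ∫ z, (Q z).2 ∂μ) :=
    ENNReal.continuous_ofReal.comp
      ((FiniteMeasure.continuous_integral_boundedContinuousFunction A).add continuous_const)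
  filter_upwards [(hcont.tendsto γ).eventually_const_lt hlt] with η hη
  exact hη.trans_le (ofReal_integral_add_le_relEntropy hconv hlsc _ μ hQc.fst.measurable
    hQc.snd.measurable (fun z => (norm_fst_le _).trans (hQM z))
    (fun z => (norm_snd_le _).trans (hQM z)) hQmem)

end LowerSemicontinuity

/-! ### Lower semicontinuous integrands as limits of Lipschitz functions -/

section LowerSemicontinuousIntegrand

variable {Z : Type*} [PseudoMetricSpace Z]

/-- The infimal convolution of `min g n` with `n` times the distance. -/
noncomputable def infConvDist (g : Z → ℝ≥0∞) (n : ℕ) (x : Z) : ℝ≥0∞ :=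
  ⨅ y, (min (g y) n + n * edist x y)

variable {g : Z → ℝ≥0∞}

theorem infConvDist_le_self (n : ℕ) (x : Z) : infConvDist g n x ≤ g x :=
  (iInf_le _ x).trans (by simp)

theorem infConvDist_le_nat (n : ℕ) (x : Z) : infConvDist g n x ≤ n :=
  (iInf_le _ x).trans (by simp)

theorem infConvDist_ne_top (n : ℕ) (x : Z) : infConvDist g n x ≠ ⊤ :=
  ((infConvDist_le_nat n x).trans_lt (ENNReal.natCast_lt_top n)).ne

theorem infConvDist_mono : Monotone (infConvDist g) := fun m n hmn x => by
  refine iInf_mono fun y => ?_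
  have h : (m : ℝ≥0∞) ≤ n := by exact_mod_cast hmn
  gcongr

theorem infConvDist_le_add (n : ℕ) (x x' : Z) :
    infConvDist g n x ≤ infConvDist g n x' + n * edist x x' := by
  rw [infConvDist, infConvDist, ENNReal.iInf_add]
  refine le_iInf fun y => (iInf_le _ y).trans ?_
  calc _ ≤ min (g y) n + n * (edist x x' + edist x' y) := by
        gcongr
        exact edist_triangle _ _ _
    _ = _ := by ring

/-- For `r < g x`, points near `x` have `g > r`, while points at distance at least `δ` pay `n δ >
r`. -/
theorem iSup_infConvDist (hg : LowerSemicontinuous g) (x : Z) : ⨆ n, infConvDist g n x = g x := by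
  refine le_antisymm (iSup_le fun n => infConvDist_le_self n x) (le_of_forall_lt fun y hy => ?_)
  obtain ⟨r, hyr, hr⟩ := exists_between hy
  obtain ⟨δ, hδ, hball⟩ := EMetric.mem_nhds_iff.1 (hg x r hr)
  obtain ⟨n, hn⟩ := ENNReal.exists_nat_mul_gt hδ.ne' hr.ne_top
  obtain ⟨m, hm⟩ := ENNReal.exists_nat_gt hr.ne_top
  refine hyr.trans_le (le_trans (le_iInf fun z => ?_)
    (le_iSup (fun n => infConvDist g n x) (max m n)))
  by_cases hz : edist z x < δ
  · refine le_add_right (le_min (le_of_lt (hball hz)) (hm.le.trans ?_))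
    exact_mod_cast le_max_left m n
  · refine le_add_left (hn.le.trans (mul_le_mul' ?_ ?_))
    · exact_mod_cast le_max_right m n
    · rw [edist_comm]; exact not_lt.1 hz

theorem continuous_toReal_infConvDist (n : ℕ) :
    Continuous fun x => (infConvDist g n x).toReal := by
  refine (LipschitzWith.of_le_add_mul (n : ℝ≥0) fun x x' => ?_).continuous
  have h := ENNReal.toReal_mono (ENNReal.add_ne_top.2 ⟨infConvDist_ne_top n x',
    ENNReal.mul_ne_top (ENNReal.natCast_ne_top n) (edist_ne_top x x')⟩)
    (infConvDist_le_add (g := g) n x x')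
  rwa [ENNReal.toReal_add (infConvDist_ne_top n x')
    (ENNReal.mul_ne_top (ENNReal.natCast_ne_top n) (edist_ne_top x x')), ENNReal.toReal_mul,
    ENNReal.toReal_natCast, ← dist_edist] at h

/-- Integration of a nonnegative lower semicontinuous function is weakly lower semicontinuous. -/
theorem lowerSemicontinuous_lintegral [MeasurableSpace Z] [BorelSpace Z]
    (hg : LowerSemicontinuous g) :
    LowerSemicontinuous fun γ : FiniteMeasure Z => ∫⁻ z, g z ∂(γ : Measure Z) := by
  have hm : ∀ n, Measurable (infConvDist g n) := fun n => by
    have := (continuous_toReal_infConvDist (g := g) n).measurable.ennreal_ofReal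
    simpa only [ENNReal.ofReal_toReal (infConvDist_ne_top n _)] using this
  have h : (fun γ : FiniteMeasure Z => ∫⁻ z, g z ∂(γ : Measure Z)) =
      fun γ : FiniteMeasure Z => ⨆ n, ∫⁻ z, infConvDist g n z ∂(γ : Measure Z) := by
    funext γ
    rw [← lintegral_iSup hm infConvDist_mono]
    exact lintegral_congr fun z => (iSup_infConvDist hg z).symm
  rw [h]
  refine lowerSemicontinuous_iSup fun n => Continuous.lowerSemicontinuous ?_
  let A : BoundedContinuousFunction Z ℝ := BoundedContinuousFunction.ofNormedAddCommGroup
    (fun z => (infConvDist g n z).toReal) (continuous_toReal_infConvDist n) n fun z => by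
      rw [Real.norm_of_nonneg ENNReal.toReal_nonneg]
      simpa using ENNReal.toReal_mono (ENNReal.natCast_ne_top n) (infConvDist_le_nat (g := g) n z)
  have hA : ∀ z, ((A.nnrealPart z : ℝ≥0) : ℝ≥0∞) = infConvDist g n z := fun z =>
    ENNReal.ofReal_toReal (infConvDist_ne_top n z)
  simpa only [hA] using FiniteMeasure.continuous_lintegral_boundedContinuousFunction A.nnrealPart

end LowerSemicontinuousIntegrand

/-! ### The linear cost and the coercivity constant -/

section Cost

/-- Splitting `x` and `b` into positive and negative parts, arranged without subtracting them so
that the extended version can be integrated in `ℝ≥0∞`. -/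
theorem ofReal_add_ofReal_neg_eq (x b : ℝ) (h : b ≤ x) :
    ENNReal.ofReal x + ENNReal.ofReal (-b)
      = ENNReal.ofReal (x - b) + ENNReal.ofReal (-x) + ENNReal.ofReal b := by
  simp only [ENNReal.ofReal, ← ENNReal.coe_add, ENNReal.coe_inj]
  apply NNReal.coe_injective
  simp only [NNReal.coe_add, Real.coe_toNNReal']
  grind

variable {Z : Type*} {c : Z → EReal}

theorem toENNReal_add_ofReal_neg_eq {x : EReal} {b : ℝ} (h : (b : EReal) ≤ x) :
    x.toENNReal + ENNReal.ofReal (-b)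
      = (x - b).toENNReal + (-x).toENNReal + ENNReal.ofReal b := by
  induction x with
  | bot => simp at h
  | top => simp
  | coe x =>
    rw [← EReal.coe_sub, ← EReal.coe_neg]
    simpa only [EReal.real_coe_toENNReal] using ofReal_add_ofReal_neg_eq x b (by exact_mod_cast h)

/-- The linear cost in terms of a nonnegative integrand, for a cost bounded below by `b`. -/
theorem linearCost_eq [MeasurableSpace Z] (hc : Measurable c) {b : ℝ}
    (hb : ∀ z, (b : EReal) ≤ c z) (γ : Measure Z) [IsFiniteMeasure γ] :
    linearCost c γ = ((∫⁻ z, (c z - b).toENNReal ∂γ : ℝ≥0∞) : EReal)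
      + ((b * γ.real Set.univ : ℝ) : EReal) := by
  have hneg : ∫⁻ z, (-c z).toENNReal ∂γ ≠ ⊤ := by
    have h : ∫⁻ z, (-c z).toENNReal ∂γ ≤ ∫⁻ _, ENNReal.ofReal (-b) ∂γ :=
      lintegral_mono fun z => by
        have := EReal.toENNReal_le_toENNReal (EReal.neg_le_neg_iff.2 (hb z))
        rwa [← EReal.coe_neg, EReal.real_coe_toENNReal] at this
    refine (h.trans_lt ?_).ne
    rw [lintegral_const]
    exact ENNReal.mul_lt_top ENNReal.ofReal_lt_top (measure_lt_top γ _)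
  have key : ∫⁻ z, (c z).toENNReal ∂γ + ENNReal.ofReal (-b) * γ Set.univ
      = ∫⁻ z, (c z - b).toENNReal ∂γ + ∫⁻ z, (-c z).toENNReal ∂γ
        + ENNReal.ofReal b * γ Set.univ := by
    have h := lintegral_congr (μ := γ) fun z => toENNReal_add_ofReal_neg_eq (hb z)
    rwa [lintegral_add_right _ measurable_const, lintegral_add_right _ measurable_const,
      lintegral_add_right _ (show Measurable fun z => (-c z).toENNReal from hc.neg.ereal_toENNReal),
       lintegral_const, lintegral_const] at h
  have hu : γ Set.univ = ENNReal.ofReal (γ.real Set.univ) := (ofReal_measureReal).symm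
  have hm : 0 ≤ γ.real Set.univ := measureReal_nonneg
  rw [linearCost]
  rw [hu, ← ENNReal.ofReal_mul' hm, ← ENNReal.ofReal_mul' hm] at key
  set m := γ.real Set.univ
  generalize ∫⁻ z, (c z).toENNReal ∂γ = P at key ⊢
  generalize ∫⁻ z, (c z - b).toENNReal ∂γ = G at key ⊢
  generalize ∫⁻ z, (-c z).toENNReal ∂γ = N at key hneg ⊢
  lift N to ℝ≥0 using hneg
  by_cases hG : G = ⊤
  · subst hG
    have hP : P = ⊤ := by
      by_contra h
      simp [h] at key
    subst hP
    rw [EReal.coe_ennreal_top, EReal.top_add_coe]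
    rfl
  · have hP : P ≠ ⊤ := by
      intro h
      subst h
      rw [top_add] at key
      exact absurd key.symm (ENNReal.add_ne_top.2
        ⟨ENNReal.add_ne_top.2 ⟨hG, ENNReal.coe_ne_top⟩, ENNReal.ofReal_ne_top⟩)
    lift G to ℝ≥0 using hG
    lift P to ℝ≥0 using hP
    simp only [ENNReal.ofReal, ← ENNReal.coe_add, ENNReal.coe_inj] at key
    have key' := congrArg NNReal.toReal key
    simp only [NNReal.coe_add, Real.coe_toNNReal'] at key'
    have : (P : ℝ) - N = G + b * m := by
      have e : max (b * m) 0 - max (-b * m) 0 = b * m := by grind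
      linarith
    change ((P : ℝ) : EReal) - ((N : ℝ) : EReal) = ((G : ℝ) : EReal) + ((b * m : ℝ) : EReal)
    exact_mod_cast this

theorem lowerSemicontinuous_toENNReal_sub [TopologicalSpace Z] (hc : LowerSemicontinuous c)
    (b : ℝ) : LowerSemicontinuous fun z => (c z - b).toENNReal := by
  have hcont : Continuous fun x : EReal => (x - b).toENNReal := by
    refine Continuous.ereal_toENNReal (continuous_iff_continuousAt.2 fun x => ?_)
    simp only [sub_eq_add_neg, ← EReal.coe_neg]
    exact (EReal.continuousAt_add (p := (x, ((-b : ℝ) : EReal))) (Or.inr (EReal.coe_ne_bot _))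
      (Or.inr (EReal.coe_ne_top _))).comp (f := fun x : EReal => (x, ((-b : ℝ) : EReal)))
      (by fun_prop)
  exact hcont.comp_lowerSemicontinuous hc fun x y hxy =>
    EReal.toENNReal_le_toENNReal (EReal.sub_le_sub hxy le_rfl)

/-- The two marginal entropies and the `ε` term each contribute the slope `p.1` per unit mass, the
cost contributes `b`. Slopes approach the recession constant, so the strict inequality survives for
some minorant. -/
theorem exists_coercive_bound {F : ℝ≥0 → ℝ≥0∞} {ε : ℝ}
    (hconv : ConvexOn ℝ≥0 Set.univ F) (hlsc : LowerSemicontinuous F)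
    (hc_bdd : ∃ b : ℝ, ∀ p, (b : EReal) ≤ c p) (hε : 0 < ε)
    (h : recession F = ⊤ ∨
      0 < ((2 + ε : ℝ) : EReal) * (recession F : EReal) + ⨅ p, c p) :
    ∃ p ∈ affineMinorants F, ∃ b : ℝ, (∀ z, (b : EReal) ≤ c z) ∧ 0 < (2 + ε) * p.1 + b := by
  obtain ⟨b, hb⟩ := hc_bdd
  by_cases hrec : recession F = ⊤
  · obtain ⟨p, hp, hlt⟩ := exists_affineMinorant_slope_gt hconv hlsc
      (r := ENNReal.ofReal (|b| + 1)) (by simp [hrec])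
    rw [ENNReal.ofReal_lt_ofReal_iff_of_nonneg (by positivity)] at hlt
    exact ⟨p, hp, b, hb, by nlinarith [neg_abs_le b, abs_nonneg b]⟩
  have h' := h.resolve_left hrec
  have hbI : (b : EReal) ≤ ⨅ p, c p := le_iInf hb
  have hIc : ∀ z, ⨅ p, c p ≤ c z := fun z => iInf_le c z
  generalize (⨅ p, c p) = I at h' hbI hIc
  have h2 : (0 : ℝ) < 2 + ε := by positivity
  induction I with
  | bot => simp at hbI
  | top =>
    exact ⟨(0, 0), zero_mem_affineMinorants, 1, fun z => le_top.trans (hIc z), by simp⟩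
  | coe i =>
    by_cases hi : 0 < i
    · exact ⟨(0, 0), zero_mem_affineMinorants, i, hIc, by simpa using hi⟩
    have hpos : 0 ≤ -i / (2 + ε) := div_nonneg (by linarith) h2.le
    have hlt : ENNReal.ofReal (-i / (2 + ε)) < recession F := by
      generalize recession F = R at h' hrec
      lift R to ℝ≥0 using hrec
      change (0 : EReal) < ((2 + ε : ℝ) : EReal) * ((R : ℝ) : EReal) + (i : EReal) at h'
      norm_cast at h'
      rw [← ENNReal.ofReal_coe_nnreal, ENNReal.ofReal_lt_ofReal_iff_of_nonneg hpos,
        div_lt_iff₀ h2]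
      linarith
    obtain ⟨p, hp, hp1⟩ := exists_affineMinorant_slope_gt hconv hlsc hlt
    rw [ENNReal.ofReal_lt_ofReal_iff_of_nonneg hpos, div_lt_iff₀ h2] at hp1
    exact ⟨p, hp, i, hIc, by linarith⟩

end Cost

/-! ### Semicontinuity and a priori bounds for the functional -/

section Functional

variable {X : Type*} [MeasurableSpace X] {F : ℝ≥0 → ℝ≥0∞} {c : X × X → EReal} {ε b : ℝ}
  {μ₀ μ₁ : FiniteMeasure X} {ν : FiniteMeasure (X × X)}

/-- The regularised functional with the cost `c` replaced by the positive part of `c - b`. -/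
noncomputable def shiftedPrimalReg (F : ℝ≥0 → ℝ≥0∞) (c : X × X → EReal) (ε b : ℝ)
    (μ₀ μ₁ : FiniteMeasure X) (ν γ : FiniteMeasure (X × X)) : ℝ≥0∞ :=
  relEntropy F (γ : Measure (X × X)).fst μ₀ + relEntropy F (γ : Measure (X × X)).snd μ₁
    + ∫⁻ z, (c z - b).toENNReal ∂(γ : Measure (X × X))
    + ENNReal.ofReal ε * relEntropy F (γ : Measure (X × X)) ν

/-- All possible negativity is put into `b` times the mass, which is finite and weakly continuous.
-/
theorem primalReg_eq (hc : Measurable c) (hε : 0 < ε) (hb : ∀ z, (b : EReal) ≤ c z)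
    (γ : FiniteMeasure (X × X)) :
    primalReg F c ε μ₀ μ₁ ν γ = (shiftedPrimalReg F c ε b μ₀ μ₁ ν γ : EReal)
      + ((b * (γ : Measure (X × X)).real Set.univ : ℝ) : EReal) := by
  have hε' : (ε : EReal) = ((ENNReal.ofReal ε : ℝ≥0∞) : EReal) := by
    rw [EReal.coe_ennreal_ofReal, max_eq_left hε.le]
  rw [primalReg, primal, shiftedPrimalReg, linearCost_eq hc hb, hε']
  simp only [EReal.coe_ennreal_add, EReal.coe_ennreal_mul]
  abel

theorem lowerSemicontinuous_primalReg [MetricSpace X] [SecondCountableTopology X] [BorelSpace X]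
    (hconv : ConvexOn ℝ≥0 Set.univ F) (hlsc : LowerSemicontinuous F)
    (hc : LowerSemicontinuous c) (hε : 0 < ε) (hb : ∀ z, (b : EReal) ≤ c z) :
    LowerSemicontinuous (primalReg F c ε μ₀ μ₁ ν) := by
  have hJ : LowerSemicontinuous (shiftedPrimalReg F c ε b μ₀ μ₁ ν) := by
    have h₀ := (lowerSemicontinuous_relEntropy hconv hlsc (μ₀ : Measure X)).comp
      (FiniteMeasure.continuous_map (continuous_fst (X := X) (Y := X)))
    have h₁ := (lowerSemicontinuous_relEntropy hconv hlsc (μ₁ : Measure X)).comp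
      (FiniteMeasure.continuous_map (continuous_snd (X := X) (Y := X)))
    have h₂ := lowerSemicontinuous_lintegral (lowerSemicontinuous_toENNReal_sub hc b)
    have h₃ := (ENNReal.continuous_const_mul (ENNReal.ofReal_ne_top (r := ε))
      ).comp_lowerSemicontinuous (lowerSemicontinuous_relEntropy hconv hlsc (ν : Measure (X × X)))
      fun x y hxy => mul_le_mul_right hxy _
    exact ((h₀.add h₁).add h₂).add h₃
  have hm : Continuous fun γ : FiniteMeasure (X × X) =>
      ((b * (γ : Measure (X × X)).real Set.univ : ℝ) : EReal) := by
    refine continuous_coe_real_ereal.comp (continuous_const.mul ?_)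
    exact NNReal.continuous_coe.comp FiniteMeasure.continuous_mass
  have heq : primalReg F c ε μ₀ μ₁ ν = fun γ => (shiftedPrimalReg F c ε b μ₀ μ₁ ν γ : EReal)
      + ((b * (γ : Measure (X × X)).real Set.univ : ℝ) : EReal) :=
    funext fun γ => primalReg_eq hc.measurable hε hb γ
  rw [heq]
  refine (continuous_coe_ennreal_ereal.comp_lowerSemicontinuous hJ fun x y hxy =>
    EReal.coe_ennreal_le_coe_ennreal_iff.2 hxy).add' hm.lowerSemicontinuous fun γ => ?_
  exact EReal.continuousAt_add (Or.inr (EReal.coe_ne_bot _)) (Or.inr (EReal.coe_ne_top _))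

/-- Test with the minorant `p` on `E` and zero elsewhere. The whole space yields the mass bound, the
complement of a compact set yields tightness. -/
theorem ofReal_mass_le_relEntropy {Z : Type*} [MeasurableSpace Z]
    (hconv : ConvexOn ℝ≥0 Set.univ F) (hlsc : LowerSemicontinuous F) {p : ℝ × ℝ}
    (hp : p ∈ affineMinorants F) (γ μ : Measure Z) [IsFiniteMeasure γ] [IsFiniteMeasure μ]
    {E : Set Z} (hE : MeasurableSet E) :
    ENNReal.ofReal (p.1 * γ.real E + p.2 * μ.real E) ≤ relEntropy F γ μ := by
  have hbd : ∀ a : ℝ, |a| ≤ |p.1| + |p.2| →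
      ∀ z, |E.indicator (fun _ => a) z| ≤ |p.1| + |p.2| := by
    intro a ha z
    by_cases hz : z ∈ E
    · simpa [hz] using ha
    · simp only [hz, not_false_eq_true, Set.indicator_of_notMem, abs_zero]
      positivity
  have h := ofReal_integral_add_le_relEntropy hconv hlsc γ μ
    (A := E.indicator fun _ => p.1) (B := E.indicator fun _ => p.2)
    (measurable_const.indicator hE) (measurable_const.indicator hE)
    (hbd _ (le_add_of_nonneg_right (abs_nonneg _))) (hbd _ (le_add_of_nonneg_left (abs_nonneg _)))
    fun z => by
      by_cases hz : z ∈ E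
      · simpa [hz] using hp
      · simpa [hz] using zero_mem_affineMinorants
  simpa [integral_indicator hE, mul_comm] using h

/-- Adding the three entropy bounds with weights `1, 1, ε` to `b m` gives `κ m + D ≤ T` for the mass
`m`. Once `m ≤ M`, the nonnegative terms sum to at most `C₀`, so each is bounded. -/
theorem exists_bounds_of_primalReg_le (hconv : ConvexOn ℝ≥0 Set.univ F)
    (hlsc : LowerSemicontinuous F) (hc : Measurable c) (hε : 0 < ε)
    (hb : ∀ z, (b : EReal) ≤ c z) {p : ℝ × ℝ} (hp : p ∈ affineMinorants F)
    (hpos : 0 < (2 + ε) * p.1 + b) (T : ℝ) :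
    ∃ M C : ℝ, 0 ≤ C ∧ ∀ γ : FiniteMeasure (X × X), primalReg F c ε μ₀ μ₁ ν γ ≤ T →
      (γ : Measure (X × X)).real Set.univ ≤ M ∧
      ∫⁻ z, (c z - b).toENNReal ∂(γ : Measure (X × X)) ≤ ENNReal.ofReal C ∧
      relEntropy F (γ : Measure (X × X)) ν ≤ ENNReal.ofReal C := by
  set κ := (2 + ε) * p.1 + b with hκ
  set D := p.2 * (μ₀ : Measure X).real Set.univ + p.2 * (μ₁ : Measure X).real Set.univ
    + ε * (p.2 * (ν : Measure (X × X)).real Set.univ) with hD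
  set M := |T - D| / κ with hM
  set C₀ := |T| + |b| * M with hC₀
  have hM0 : 0 ≤ M := by positivity
  have hC₀0 : 0 ≤ C₀ := by positivity
  refine ⟨M, max C₀ (C₀ / ε), hC₀0.trans (le_max_left _ _), fun γ hγ => ?_⟩
  rw [primalReg_eq hc hε hb] at hγ
  set m := (γ : Measure (X × X)).real Set.univ with hm
  have hm0 : 0 ≤ m := measureReal_nonneg
  have r₀ := ofReal_mass_le_relEntropy hconv hlsc hp (γ : Measure (X × X)).fst (μ₀ : Measure X)
    MeasurableSet.univ
  have r₁ := ofReal_mass_le_relEntropy hconv hlsc hp (γ : Measure (X × X)).snd (μ₁ : Measure X)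
    MeasurableSet.univ
  have r₂ := ofReal_mass_le_relEntropy hconv hlsc hp (γ : Measure (X × X))
    (ν : Measure (X × X)) MeasurableSet.univ
  have e₀ : (γ : Measure (X × X)).fst.real Set.univ = m := by
    rw [measureReal_def, Measure.fst_univ, hm, measureReal_def]
  have e₁ : (γ : Measure (X × X)).snd.real Set.univ = m := by
    rw [measureReal_def, Measure.snd_univ, hm, measureReal_def]
  rw [e₀] at r₀
  rw [e₁] at r₁
  have htop : shiftedPrimalReg F c ε b μ₀ μ₁ ν γ ≠ ⊤ := fun h => by
    rw [h, EReal.coe_ennreal_top, EReal.top_add_coe] at hγ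
    exact absurd hγ (by simp)
  rw [shiftedPrimalReg] at hγ htop
  generalize relEntropy F (γ : Measure (X × X)).fst μ₀ = R₀ at *
  generalize relEntropy F (γ : Measure (X × X)).snd μ₁ = R₁ at *
  generalize relEntropy F (γ : Measure (X × X)) ν = R₂ at *
  generalize ∫⁻ z, (c z - b).toENNReal ∂(γ : Measure (X × X)) = G at *
  have hR₂ : R₂ ≠ ⊤ := fun h => htop (by simp [h, hε])
  have hR₀ : R₀ ≠ ⊤ := fun h => htop (by simp [h])
  have hR₁ : R₁ ≠ ⊤ := fun h => htop (by simp [h])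
  have hG : G ≠ ⊤ := fun h => htop (by simp [h])
  lift R₀ to ℝ≥0 using hR₀
  lift R₁ to ℝ≥0 using hR₁
  lift R₂ to ℝ≥0 using hR₂
  lift G to ℝ≥0 using hG
  have hsum : (R₀ : ℝ) + R₁ + G + ε * R₂ + b * m ≤ T := by
    have hε' : ENNReal.ofReal ε = ((ε.toNNReal : ℝ≥0) : ℝ≥0∞) := rfl
    rw [hε', ← ENNReal.coe_mul, ← ENNReal.coe_add, ← ENNReal.coe_add, ← ENNReal.coe_add] at hγ
    change (((R₀ + R₁ + G + ε.toNNReal * R₂ : ℝ≥0) : ℝ) : EReal) + ((b * m : ℝ) : EReal) ≤ T at hγ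
    norm_cast at hγ
    simpa [Real.coe_toNNReal ε hε.le] using hγ
  rw [ENNReal.ofReal_le_iff_le_toReal ENNReal.coe_ne_top, ENNReal.coe_toReal] at r₀ r₁ r₂
  have hG0 := G.coe_nonneg
  have hR0 := R₀.coe_nonneg
  have hR1 := R₁.coe_nonneg
  have hR2 : 0 ≤ ε * (R₂ : ℝ) := mul_nonneg hε.le R₂.coe_nonneg
  have hmM : m ≤ M := by
    rw [hM, le_div_iff₀ hpos]
    refine le_trans ?_ (le_abs_self _)
    have := mul_le_mul_of_nonneg_left r₂ hε.le
    rw [hκ, hD]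
    linarith
  have hbm : -(b * m) ≤ |b| * M := by
    have h1 : -(b * m) ≤ |b| * m := by nlinarith [neg_abs_le b]
    exact h1.trans (mul_le_mul_of_nonneg_left hmM (abs_nonneg b))
  have hT := le_abs_self T
  refine ⟨hmM, ?_, ?_⟩
  · rw [← ENNReal.ofReal_coe_nnreal]
    refine ENNReal.ofReal_le_ofReal (le_trans ?_ (le_max_left _ _))
    rw [hC₀]; linarith
  · rw [← ENNReal.ofReal_coe_nnreal]
    refine ENNReal.ofReal_le_ofReal (le_trans ?_ (le_max_right _ _))
    rw [le_div_iff₀ hε, hC₀]; linarith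

end Functional

/-! ### Tightness in the two coercive cases -/

section Tightness

variable {Z : Type*} [MeasurableSpace Z] [MetricSpace Z]

/-- A slope above `(C + 1) / δ` forces small `γ`-mass wherever `ν` is small enough that `p.2 *
ν.real Kᶜ ≥ -1`; tightness of `ν` supplies the compact set. -/
theorem exists_isCompact_of_superlinear [BorelSpace Z] [CompleteSpace Z] [SecondCountableTopology Z]
    {F : ℝ≥0 → ℝ≥0∞} (hconv : ConvexOn ℝ≥0 Set.univ F) (hlsc : LowerSemicontinuous F)
    (hrec : recession F = ⊤) (ν : Measure Z) [IsFiniteMeasure ν] {C : ℝ} (hC : 0 ≤ C)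
    {δ : ℝ≥0} (hδ : 0 < δ) :
    ∃ K : Set Z, IsCompact K ∧ ∀ γ : Measure Z, IsFiniteMeasure γ →
      relEntropy F γ ν ≤ ENNReal.ofReal C → γ.real Kᶜ ≤ δ := by
  have hδ' : (0 : ℝ) < δ := hδ
  have hk : 0 ≤ (C + 1) / δ := by positivity
  obtain ⟨p, hp, hlt⟩ := exists_affineMinorant_slope_gt hconv hlsc
    (r := ENNReal.ofReal ((C + 1) / δ)) (by simp [hrec])
  rw [ENNReal.ofReal_lt_ofReal_iff_of_nonneg hk, div_lt_iff₀ hδ'] at hlt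
  have hη : 0 < 1 / (|p.2| + 1) := by positivity
  obtain ⟨K, hK, hKν⟩ := isTightMeasureSet_iff_exists_isCompact_measure_compl_le.1
    (isTightMeasureSet_singleton (μ := ν)) _ (ENNReal.ofReal_pos.2 hη)
  have hνK : ν.real Kᶜ ≤ 1 / (|p.2| + 1) :=
    ENNReal.toReal_le_of_le_ofReal hη.le (hKν ν rfl)
  have hβ : -1 ≤ p.2 * ν.real Kᶜ := by
    have h1 : |p.2| * ν.real Kᶜ ≤ 1 := by
      have := (le_div_iff₀ (by positivity)).1 hνK
      nlinarith [measureReal_nonneg (μ := ν) (s := Kᶜ)]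
    nlinarith [neg_abs_le p.2, measureReal_nonneg (μ := ν) (s := Kᶜ)]
  refine ⟨K, hK, fun γ hγ hR => ?_⟩
  have h := (ofReal_mass_le_relEntropy hconv hlsc hp γ ν hK.measurableSet.compl).trans hR
  rw [ENNReal.ofReal_le_ofReal_iff hC] at h
  by_contra! hcon
  nlinarith [measureReal_nonneg (μ := γ) (s := Kᶜ)]

/-- Markov's inequality: outside the sublevel set at height `b + k` the integrand is at least `k =
(C + 1) / δ`. -/
theorem exists_isCompact_of_compact_sublevels {c : Z → EReal}
    (hc : Measurable c) (hcpt : ∀ k : ℝ, IsCompact {z | c z ≤ (k : EReal)}) (b : ℝ) {C : ℝ}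
    (hC : 0 ≤ C) {δ : ℝ≥0} (hδ : 0 < δ) :
    ∃ K : Set Z, IsCompact K ∧ ∀ γ : Measure Z, IsFiniteMeasure γ →
      ∫⁻ z, (c z - b).toENNReal ∂γ ≤ ENNReal.ofReal C → γ.real Kᶜ ≤ δ := by
  have hδ' : (0 : ℝ) < δ := hδ
  set k := (C + 1) / δ with hk
  have hk0 : 0 < k := by positivity
  refine ⟨_, hcpt (b + k), fun γ hγ hG => ?_⟩
  have hsub : {z | c z ≤ ((b + k : ℝ) : EReal)}ᶜ
      ⊆ {z | ENNReal.ofReal k ≤ (c z - b).toENNReal} := fun z hz => by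
    have hz' : ((b + k : ℝ) : EReal) < c z := not_le.1 hz
    have h : ((b + k : ℝ) : EReal) - b ≤ c z - b := EReal.sub_le_sub hz'.le le_rfl
    rw [← EReal.coe_sub, add_sub_cancel_left] at h
    exact EReal.toENNReal_le_toENNReal h
  have hm : Measurable fun z => (c z - b).toENNReal :=
    (hc.sub measurable_const).ereal_toENNReal
  have h := (mul_le_mul_right (measure_mono hsub) (ENNReal.ofReal k)).trans
    ((mul_meas_ge_le_lintegral (μ := γ) hm (ENNReal.ofReal k)).trans hG)
  rw [← ofReal_measureReal (μ := γ), ← ENNReal.ofReal_mul hk0.le,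
    ENNReal.ofReal_le_ofReal_iff hC] at h
  by_contra! hcon
  have : k * δ = C + 1 := div_mul_cancel₀ _ hδ'.ne'
  nlinarith

end Tightness

/-! ### The direct method -/

section Existence

/-- A lower semicontinuous functional on finite measures attains its infimum if each of its
sublevel sets is bounded in mass and uniformly tight. -/
theorem exists_eq_iInf_of_tight {Z : Type*} [MeasurableSpace Z] [MetricSpace Z] [BorelSpace Z]
    {J : FiniteMeasure Z → EReal} (hJ : LowerSemicontinuous J) (hbot : ∀ γ, J γ ≠ ⊥)
    (htight : ∀ T : ℝ, (∃ M : ℝ, ∀ γ, J γ ≤ T → (γ : Measure Z).real Set.univ ≤ M) ∧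
      ∀ δ : ℝ≥0, 0 < δ → ∃ K : Set Z, IsCompact K ∧
        ∀ γ, J γ ≤ T → (γ : Measure Z).real Kᶜ ≤ δ) :
    ∃ γ, J γ = ⨅ η, J η := by
  by_cases htop : ∀ γ, J γ = ⊤
  · exact ⟨0, by simp [htop]⟩
  push Not at htop
  obtain ⟨γ₀, hγ₀⟩ := htop
  set T := (J γ₀).toReal with hT
  have hγ₀T : J γ₀ ≤ T := by rw [hT, EReal.coe_toReal hγ₀ (hbot γ₀)]
  obtain ⟨⟨M, hM⟩, hK⟩ := htight T
  have hu : ∀ n : ℕ, (0 : ℝ≥0) < 1 / ((n : ℝ≥0) + 1) := fun n => by positivity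
  choose K hKc hKγ using fun n : ℕ => hK _ (hu n)
  -- Prokhorov: bounded mass and uniform smallness off the `K n` define a compact set. It contains
  -- the sublevel set at `T`, so a minimiser on it is global.
  have hcpt := isCompact_setOfPred_finiteMeasure_mass_le_compl_isCompact_le (E := Z)
    M.toNNReal (tendsto_one_div_add_atTop_nhds_zero_nat (𝕜 := ℝ≥0)) hKc (Or.inl inferInstance)
  have hmem : ∀ γ, J γ ≤ T → γ ∈ {μ : FiniteMeasure Z | μ.mass ≤ M.toNNReal ∧
      ∀ n : ℕ, μ (K n)ᶜ ≤ 1 / ((n : ℝ≥0) + 1)} := fun γ hγ =>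
    ⟨NNReal.le_toNNReal_of_coe_le (hM γ hγ), fun n => hKγ n γ hγ⟩
  obtain ⟨γ, -, hmin⟩ := (hJ.lowerSemicontinuousOn _).exists_isMinOn ⟨γ₀, hmem γ₀ hγ₀T⟩ hcpt
  refine ⟨γ, le_antisymm (le_iInf fun η => ?_) (iInf_le J γ)⟩
  rcases le_or_gt (J η) T with h | h
  · exact hmin (hmem η h)
  · exact (hmin (hmem γ₀ hγ₀T)).trans (hγ₀T.trans h.le)

end Existence

end UnbalancedOT

/-! ### The existence theorem -/

theorem mainTheorem10 {X : Type*} [MetricSpace X] [CompleteSpace X]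
    [TopologicalSpace.SeparableSpace X] [MeasurableSpace X] [BorelSpace X]
    (F : ℝ≥0 → ℝ≥0∞) (hF_convex : ConvexOn ℝ≥0 Set.univ F) (hF_lsc : LowerSemicontinuous F)
    (c : X × X → EReal) (hc_lsc : LowerSemicontinuous c)
    (hc_bdd : ∃ b : ℝ, ∀ p, (b : EReal) ≤ c p)
    (ε : ℝ) (hε : 0 < ε)
    (hcoercive : UnbalancedOT.recession F = ⊤ ∨
      ((∀ k : ℝ, IsCompact {p : X × X | c p ≤ (k : EReal)}) ∧
        0 < ((2 + ε : ℝ) : EReal) * (UnbalancedOT.recession F : EReal) + ⨅ p, c p))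
    (μ₀ μ₁ : FiniteMeasure X) (ν : FiniteMeasure (X × X)) :
    ∃ γ : FiniteMeasure (X × X),
      UnbalancedOT.primalReg F c ε μ₀ μ₁ ν γ = UnbalancedOT.UOTReg F c ε μ₀ μ₁ ν := by
  have : SecondCountableTopology X := UniformSpace.secondCountable_of_separable X
  obtain ⟨p, hp, b, hb, hpos⟩ := UnbalancedOT.exists_coercive_bound hF_convex hF_lsc hc_bdd hε
    (hcoercive.imp_right And.right)
  refine UnbalancedOT.exists_eq_iInf_of_tight
    (UnbalancedOT.lowerSemicontinuous_primalReg hF_convex hF_lsc hc_lsc hε hb) (fun γ => ?_)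
    fun T => ?_
  · rw [UnbalancedOT.primalReg_eq hc_lsc.measurable hε hb, Ne, EReal.add_eq_bot_iff]
    exact not_or.2 ⟨EReal.coe_ennreal_ne_bot _, EReal.coe_ne_bot _⟩
  · obtain ⟨M, C, hC, hbound⟩ := UnbalancedOT.exists_bounds_of_primalReg_le (μ₀ := μ₀)
      (μ₁ := μ₁) (ν := ν) hF_convex hF_lsc hc_lsc.measurable hε hb hp hpos T
    refine ⟨⟨M, fun γ hγ => (hbound γ hγ).1⟩, fun δ hδ => ?_⟩
    rcases hcoercive with hrec | ⟨hcpt, -⟩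
    · obtain ⟨K, hK, h⟩ := UnbalancedOT.exists_isCompact_of_superlinear hF_convex hF_lsc hrec
        (ν : Measure (X × X)) hC hδ
      exact ⟨K, hK, fun γ hγ => h γ inferInstance (hbound γ hγ).2.2⟩
    · obtain ⟨K, hK, h⟩ := UnbalancedOT.exists_isCompact_of_compact_sublevels hc_lsc.measurable
        hcpt b hC hδ
      exact ⟨K, hK, fun γ hγ => h γ inferInstance (hbound γ hγ).2.1⟩
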